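/- Throughout, Banach spaces are over $\mathbb{K}\in\{\mathbb{R},\mathbb{C}\}$. For a Banach space $X$, a set $K\subseteq X^*$ and $\varepsilon>0$ let $$\iota_\varepsilon K=\{x^*\in K:\ \operatorname{diam}(K\cap U)>\varepsilon\text{ for every weak}^*\text{-open neighbourhood }U\text{ of }x^*\},$$ where the diameter is taken in the dual norm. We say that $X$ has \emph{summable Szlenk index} if there is a constant $M$ such that for all positive $\varepsilon_1,\dots,\varepsilon_n$ with $\iota_{\varepsilon_1}\cdots\iota_{\varepsilon_n}B_{X^*}\neq\varnothing$ one has $\sum_{i=1}^n\varepsilon_i\le M$; here $B_{X^*}$ is the closed unit ball of $X^*$. Let $E$ be a Banach space with an unconditional basis $(e_n)_{n=1}^\infty$. For a sequence $(X_n)_{n=1}^\infty$ of Banach spaces, $\bigl(\bigoplus_{n=1}^\infty X_n\bigr)_E$ denotes the space of all sequences $(x_n)\in\prod_n X_n$ for which the series $\sum_{n=1}^\infty\|x_n\|e_n$ converges, with coordinatewise operations and the norm $$\|(x_n)\|=\sup\Bigl\{\Bigl\|\sum_{n=1}^\infty a_ne_n\Bigr\|:\ \sum_{n=1}^\infty a_ne_n\text{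 converges in }E,\ |a_n|\le\|x_n\|\text{ for all }n\Bigr\}.$$ If the basis is $1$-unconditional (that is, $\|\sum a_ne_n\|\le\|\sum c_ne_n\|$ for finite sums with $|a_n|\le|c_n|$), this norm equals $\bigl\|\sum_{n=1}^\infty\|x_n\|e_n\bigr\|$. \textbf{Theorem.} Let $E$ be a Banach space with an unconditional basis and summable Szlenk index. Then for every sequence $(X_n)_{n=1}^\infty$ of finite-dimensional Banach spaces the space $\bigl(\bigoplus_{n=1}^\infty X_n\bigr)_E$ has summable Szlenk index. -/

import Mathlib

noncomputable section

open scoped Topology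

/-! ### Szlenk derivations and summability of the Szlenk index -/

/-- The `ε`-Szlenk derivation of a set `K ⊆ X*`: the points `f ∈ K` such that
`diam (K ∩ U) > ε` (norm diameter) for every weak*-open neighbourhood `U` of `f`.
The type `WeakDual 𝕜 X` is the dual of `X` with the weak* topology; the diameter is computed in
the dual norm, after passing to `StrongDual 𝕜 X`. -/
def szlenkDerivation (𝕜 : Type*) {X : Type*} [RCLike 𝕜] [NormedAddCommGroup X] [NormedSpace 𝕜 X]
    (ε : ℝ) (K : Set (WeakDual 𝕜 X)) : Set (WeakDual 𝕜 X) :=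
  {f | f ∈ K ∧ ∀ U : Set (WeakDual 𝕜 X), IsOpen U → f ∈ U →
    ENNReal.ofReal ε < Metric.ediam (WeakDual.toStrongDual '' (K ∩ U))}

/-- The closed unit ball of the dual space. -/
def dualUnitBall (𝕜 : Type*) (X : Type*) [RCLike 𝕜] [NormedAddCommGroup X] [NormedSpace 𝕜 X] :
    Set (WeakDual 𝕜 X) :=
  {f | ‖WeakDual.toStrongDual f‖ ≤ 1}

/-- The composition `ι_{ε₁} ⋯ ι_{εₙ} K` for the list `[ε₁, …, εₙ]`. -/
def iteratedSzlenkDerivation (𝕜 : Type*) {X : Type*} [RCLike 𝕜] [NormedAddCommGroup X]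
    [NormedSpace 𝕜 X] (l : List ℝ) (K : Set (WeakDual 𝕜 X)) : Set (WeakDual 𝕜 X) :=
  l.foldr (szlenkDerivation 𝕜) K

/-- `X` has summable Szlenk index: there is `M` such that `ε₁ + ⋯ + εₙ ≤ M` for all positive
`ε₁, …, εₙ` with `ι_{ε₁} ⋯ ι_{εₙ} B_{X*} ≠ ∅`. -/
def HasSummableSzlenkIndex (𝕜 : Type*) (X : Type*) [RCLike 𝕜] [NormedAddCommGroup X]
    [NormedSpace 𝕜 X] : Prop :=
  ∃ M : ℝ, ∀ l : List ℝ, (∀ ε ∈ l, 0 < ε) →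
    (iteratedSzlenkDerivation 𝕜 l (dualUnitBall 𝕜 X)).Nonempty → l.sum ≤ M

/-! ### Facts on unconditional bases that are needed to define direct sums -/

section Facts

variable {𝕜 E : Type*} [RCLike 𝕜] [NormedAddCommGroup E] [NormedSpace 𝕜 E]

lemma norm_le_re_im (z : 𝕜) : ‖z‖ ≤ |RCLike.re z| + |RCLike.im z| := by
  refine abs_le_of_sq_le_sq' ?_ (by positivity) |>.2
  rw [RCLike.norm_sq_eq_def]
  nlinarith [sq_abs (RCLike.re z), sq_abs (RCLike.im z),
    mul_nonneg (abs_nonneg (RCLike.re z)) (abs_nonneg (RCLike.im z))]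

/-- If all subsums of a finite family are small, so are its sums with multipliers in the unit
disc. -/
lemma norm_sum_smul_le_of_subsums (A : Finset ℕ) (w : ℕ → E) (c : ℕ → 𝕜) (δ : ℝ)
    (hc : ∀ n, ‖c n‖ ≤ 1) (hw : ∀ B ⊆ A, ‖∑ n ∈ B, w n‖ ≤ δ) :
    ‖∑ n ∈ A, c n • w n‖ ≤ 4 * δ := by
  classical
  obtain ⟨f, hf1, hf2⟩ := exists_dual_vector'' 𝕜 (∑ n ∈ A, c n • w n)
  have hfB : ∀ B ⊆ A, ‖∑ n ∈ B, f (w n)‖ ≤ δ := by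
    intro B hB
    rw [← map_sum]
    calc ‖f (∑ n ∈ B, w n)‖ ≤ ‖f‖ * ‖∑ n ∈ B, w n‖ := f.le_opNorm _
      _ ≤ 1 * ‖∑ n ∈ B, w n‖ := by gcongr
      _ ≤ δ := by rw [one_mul]; exact hw B hB
  have key : ∀ g : ℕ → ℝ, (∀ B ⊆ A, |∑ n ∈ B, g n| ≤ δ) → ∑ n ∈ A, |g n| ≤ 2 * δ := by
    intro g hg
    rw [← Finset.sum_filter_add_sum_filter_not A (fun n => 0 ≤ g n)]
    have h1 : ∑ n ∈ A with 0 ≤ g n, |g n| = ∑ n ∈ A with 0 ≤ g n, g n :=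
      Finset.sum_congr rfl fun n hn => abs_of_nonneg (Finset.mem_filter.1 hn).2
    have h2 : ∑ n ∈ A with ¬ 0 ≤ g n, |g n| = - ∑ n ∈ A with ¬ 0 ≤ g n, g n := by
      rw [← Finset.sum_neg_distrib]
      exact Finset.sum_congr rfl fun n hn =>
        abs_of_neg (not_le.1 (Finset.mem_filter.1 hn).2)
    rw [h1, h2]
    have h3 := (abs_le.1 (hg _ (Finset.filter_subset (fun n => 0 ≤ g n) A))).2
    have h4 := (abs_le.1 (hg _ (Finset.filter_subset (fun n => ¬ 0 ≤ g n) A))).1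
    linarith
  have hre : ∑ n ∈ A, |RCLike.re (f (w n))| ≤ 2 * δ := key _ fun B hB => by
    rw [← map_sum]; exact (RCLike.abs_re_le_norm _).trans (hfB B hB)
  have him : ∑ n ∈ A, |RCLike.im (f (w n))| ≤ 2 * δ := key _ fun B hB => by
    rw [← map_sum]; exact (RCLike.abs_im_le_norm _).trans (hfB B hB)
  have hnorm : ‖∑ n ∈ A, c n • w n‖ = ‖f (∑ n ∈ A, c n • w n)‖ := by
    rw [hf2, RCLike.norm_ofReal, abs_norm]
  rw [hnorm, map_sum]
  calc ‖∑ n ∈ A, f (c n • w n)‖ ≤ ∑ n ∈ A, ‖f (c n • w n)‖ := norm_sum_le _ _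
    _ ≤ ∑ n ∈ A, (|RCLike.re (f (w n))| + |RCLike.im (f (w n))|) := by
        refine Finset.sum_le_sum fun n _ => ?_
        rw [map_smul, norm_smul]
        calc ‖c n‖ * ‖f (w n)‖ ≤ 1 * ‖f (w n)‖ := by gcongr; exact hc n
          _ ≤ _ := by rw [one_mul]; exact norm_le_re_im _
    _ ≤ 4 * δ := by rw [Finset.sum_add_distrib]; linarith

/-- Unconditionally convergent series stay so after multiplication by bounded scalars. -/
lemma summable_smul_of_norm_le_one [CompleteSpace E] {w : ℕ → E} (hw : Summable w) {c : ℕ → 𝕜}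
    (hc : ∀ n, ‖c n‖ ≤ 1) : Summable fun n => c n • w n := by
  rw [summable_iff_vanishing_norm] at hw ⊢
  intro ε hε
  obtain ⟨s, hs⟩ := hw (ε / 5) (by positivity)
  refine ⟨s, fun t ht => ?_⟩
  have := norm_sum_smul_le_of_subsums t w c (ε / 5) hc
    fun B hB => (hs B (Finset.disjoint_of_subset_left hB ht)).le
  linarith

/-- If `∑ rₙ eₙ` converges unconditionally and `|aₙ| ≤ rₙ`, then so does `∑ aₙ eₙ`. -/
lemma summable_smul_of_dominated [CompleteSpace E] {e : ℕ → E} {r : ℕ → ℝ} {a : ℕ → 𝕜}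
    (hr : Summable fun n => (r n : 𝕜) • e n) (ha : ∀ n, ‖a n‖ ≤ r n) :
    Summable fun n => a n • e n := by
  have hr0 : ∀ n, 0 ≤ r n := fun n => (norm_nonneg _).trans (ha n)
  have := summable_smul_of_norm_le_one (c := fun n => a n / (r n : 𝕜)) hr fun n => by
    rw [norm_div, RCLike.norm_ofReal, abs_of_nonneg (hr0 n)]
    exact div_le_one_of_le₀ (ha n) (hr0 n)
  refine this.congr fun n => ?_
  rcases eq_or_ne (r n) 0 with h | h
  · have : a n = 0 := norm_le_zero_iff.1 (h ▸ ha n)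
    simp [this]
  · rw [smul_smul, div_mul_cancel₀ _ (RCLike.ofReal_ne_zero.2 h)]

namespace UnconditionalSchauderBasis

variable (b : UnconditionalSchauderBasis ℕ 𝕜 E)

lemma coord_eq_of_hasSum {a : ℕ → 𝕜} {y : E} (h : HasSum (fun n => a n • b n) y) (n : ℕ) :
    b.coord n y = a n := by
  have h1 := h.mapL (b.coord n)
  have h2 : HasSum (fun k => b.coord n (a k • b k)) (a n) := by
    have := hasSum_single (f := fun k => b.coord n (a k • b k)) n fun k hk => by
      simp [b.ortho, hk.symm]
    simpa [b.ortho] using this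
  exact h1.unique h2

lemma eq_zero_of_coords {y : E} (hy : ∀ n, b.coord n y = 0) : y = 0 := by
  have := b.expansion y
  simp only [hy, zero_smul] at this
  exact this.unique hasSum_zero

lemma basis_ne_zero (n : ℕ) : b n ≠ 0 := fun h => by
  have := b.ortho n n
  rw [h] at this
  simp at this

/-- The basis is `1`-unconditional: `‖∑ aₙ eₙ‖ ≤ ‖∑ cₙ eₙ‖` for finite sums with
`|aₙ| ≤ |cₙ|`. -/
def IsOneUnconditional : Prop :=
  ∀ (A : Finset ℕ) (a c : ℕ → 𝕜), (∀ n, ‖a n‖ ≤ ‖c n‖) →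
    ‖∑ n ∈ A, a n • b n‖ ≤ ‖∑ n ∈ A, c n • b n‖

/-- The norms of the vectors of `E` whose coordinates are dominated by `r`. -/
def dominatedNorms (r : ℕ → ℝ) : Set ℝ :=
  {t | ∃ y : E, (∀ n, ‖b.coord n y‖ ≤ r n) ∧ ‖y‖ = t}

lemma bddAbove_dominatedNorms {r : ℕ → ℝ} (hr : Summable fun n => (r n : 𝕜) • b n) :
    BddAbove (b.dominatedNorms r) := by
  let g : {y : E // ∀ n, ‖b.coord n y‖ ≤ r n} → StrongDual 𝕜 E →L[𝕜] 𝕜 :=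
    fun y => NormedSpace.inclusionInDoubleDual 𝕜 E y
  obtain ⟨C, hC⟩ := banach_steinhaus (g := g) fun f => by
    have hf : Summable fun n => ‖f ((r n : 𝕜) • b n)‖ := (hr.mapL f).norm
    refine ⟨∑' n, ‖f ((r n : 𝕜) • b n)‖, fun y => ?_⟩
    have hy := (b.expansion (y : E)).mapL f
    have hle : ∀ n, ‖f (b.coord n y • b n)‖ ≤ ‖f ((r n : 𝕜) • b n)‖ := fun n => by
      rw [map_smul, map_smul, norm_smul, norm_smul, RCLike.norm_ofReal]
      gcongr
      exact (y.2 n).trans (le_abs_self _)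
    change ‖f (y : E)‖ ≤ _
    rw [← hy.tsum_eq]
    exact tsum_of_norm_bounded hf.hasSum hle
  refine ⟨C, ?_⟩
  rintro _ ⟨y, hy, rfl⟩
  rw [← (NormedSpace.inclusionInDoubleDualLi (E := E) 𝕜).norm_map y]
  exact hC ⟨y, hy⟩

lemma zero_mem_dominatedNorms {r : ℕ → ℝ} (hr : ∀ n, 0 ≤ r n) : 0 ∈ b.dominatedNorms r :=
  ⟨0, fun n => by simpa using hr n, norm_zero⟩

end UnconditionalSchauderBasis

end Facts

/-! ### Direct sums with respect to an unconditional basis -/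

section DirectSum

variable {𝕜 E : Type*} [RCLike 𝕜] [NormedAddCommGroup E] [NormedSpace 𝕜 E] [CompleteSpace E]
  (b : UnconditionalSchauderBasis ℕ 𝕜 E)
  (X : ℕ → Type*) [∀ n, NormedAddCommGroup (X n)] [∀ n, NormedSpace 𝕜 (X n)]

/-- The sequences `(xₙ) ∈ ∏ Xₙ` such that the series `∑ ‖xₙ‖ eₙ` converges. Since `(eₙ)` is an
unconditional basis, convergence of the partial sums and unconditional convergence agree here
(see `UnconditionalSchauderBasis.mem_sumSubmodule_iff`). -/
def UnconditionalSchauderBasis.sumSubmodule : Submodule 𝕜 (∀ n, X n) where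
  carrier := {x | Summable fun n => ((‖x n‖ : ℝ) : 𝕜) • b n}
  zero_mem' := by simp [summable_zero]
  add_mem' := by
    intro x y hx hy
    refine summable_smul_of_dominated (r := fun n => ‖x n‖ + ‖y n‖) ?_ fun n => ?_
    · refine (hx.add hy).congr fun n => ?_
      rw [RCLike.ofReal_add, add_smul]
    · rw [RCLike.norm_ofReal, abs_norm]
      exact norm_add_le _ _
  smul_mem' := by
    intro c x hx
    refine (hx.const_smul ((‖c‖ : ℝ) : 𝕜)).congr fun n => ?_
    rw [Pi.smul_apply, norm_smul, RCLike.ofReal_mul, mul_smul]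

lemma UnconditionalSchauderBasis.mem_sumSubmodule_iff (x : ∀ n, X n) :
    x ∈ b.sumSubmodule X ↔ ∃ y : E, Filter.Tendsto
      (fun N => ∑ n ∈ Finset.range N, ((‖x n‖ : ℝ) : 𝕜) • b n) Filter.atTop (𝓝 y) := by
  constructor
  · exact fun h => ⟨_, h.hasSum.tendsto_sum_nat⟩
  · rintro ⟨y, hy⟩
    have hc : ∀ k, b.coord k y = ((‖x k‖ : ℝ) : 𝕜) := fun k => by
      refine tendsto_nhds_unique (((b.coord k).continuous.tendsto y).comp hy) ?_
      refine tendsto_const_nhds.congr' ?_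
      filter_upwards [Filter.eventually_gt_atTop k] with N hN
      simp [b.ortho, Pi.single_apply, hN]
    have := (b.expansion y).summable
    simp only [hc] at this
    exact this

/-- The direct sum `(⨁ Xₙ)_E` with respect to the unconditional basis `b = (eₙ)` of `E`: the space
of all sequences `(xₙ)` for which `∑ ‖xₙ‖ eₙ` converges, with coordinatewise operations. -/
def EDirectSum : Type _ := ↥(b.sumSubmodule X)

namespace EDirectSum

instance : AddCommGroup (EDirectSum b X) := inferInstanceAs (AddCommGroup ↥(b.sumSubmodule X))

instance : Module 𝕜 (EDirectSum b X) := inferInstanceAs (Module 𝕜 ↥(b.sumSubmodule X))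

variable {b X}

/-- The `n`-th coordinate of an element of the direct sum. -/
def coord (x : EDirectSum b X) (n : ℕ) : X n := x.1 n

lemma summable (x : EDirectSum b X) : Summable fun n => ((‖x.coord n‖ : ℝ) : 𝕜) • b n := x.2

/-- The norm on `(⨁ Xₙ)_E` is `sup {‖∑ aₙ eₙ‖ : |aₙ| ≤ ‖xₙ‖ for all n}`. This is
`‖∑ ‖xₙ‖ eₙ‖` whenever the basis is `1`-unconditional (see `EDirectSum.norm_eq`); for a general
unconditional basis it is the norm obtained from the lattice renorming of `E`, which is equivalent
to the given one and makes the basis `1`-unconditional. -/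
instance : Norm (EDirectSum b X) := ⟨fun x => sSup (b.dominatedNorms fun n => ‖x.coord n‖)⟩

lemma norm_def (x : EDirectSum b X) :
    ‖x‖ = sSup (b.dominatedNorms fun n => ‖x.coord n‖) := rfl

lemma le_norm (x : EDirectSum b X) (y : E) (hy : ∀ n, ‖b.coord n y‖ ≤ ‖x.coord n‖) : ‖y‖ ≤ ‖x‖ :=
  le_csSup (b.bddAbove_dominatedNorms x.summable) ⟨y, hy, rfl⟩

lemma norm_le_of (x : EDirectSum b X) {C : ℝ}
    (h : ∀ y : E, (∀ n, ‖b.coord n y‖ ≤ ‖x.coord n‖) → ‖y‖ ≤ C) : ‖x‖ ≤ C := by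
  refine csSup_le ⟨0, b.zero_mem_dominatedNorms fun n => norm_nonneg _⟩ ?_
  rintro _ ⟨y, hy, rfl⟩
  exact h y hy

lemma norm_nonneg' (x : EDirectSum b X) : 0 ≤ ‖x‖ := by
  simpa using x.le_norm 0 (by simp)

lemma norm_add_le' (x y : EDirectSum b X) : ‖x + y‖ ≤ ‖x‖ + ‖y‖ := by
  refine norm_le_of _ fun z hz => ?_
  have hz' : ∀ n, ‖b.coord n z‖ ≤ ‖x.coord n‖ + ‖y.coord n‖ :=
    fun n => (hz n).trans (norm_add_le _ _)
  let t : ℕ → ℝ := fun n => ‖x.coord n‖ / (‖x.coord n‖ + ‖y.coord n‖)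
  have ht : ∀ n, ‖b.coord n z‖ * t n ≤ ‖x.coord n‖ := fun n => by
    rcases (add_nonneg (norm_nonneg (x.coord n)) (norm_nonneg (y.coord n))).eq_or_lt' with h | h
    · simp [t, h]
    · calc ‖b.coord n z‖ * t n ≤ (‖x.coord n‖ + ‖y.coord n‖) * t n := by
            exact mul_le_mul_of_nonneg_right (hz' n)
              (div_nonneg (norm_nonneg _) h.le)
        _ = ‖x.coord n‖ := by simp only [t]; field_simp
  have ht0 : ∀ n, 0 ≤ t n := fun n => by positivity
  let u : ℕ → 𝕜 := fun n => b.coord n z * (t n : 𝕜)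
  have hu : ∀ n, ‖u n‖ ≤ ‖x.coord n‖ := fun n => by
    simp only [u, norm_mul, RCLike.norm_ofReal, abs_of_nonneg (ht0 n)]
    exact ht n
  have hs : Summable fun n => u n • b n := summable_smul_of_dominated x.summable hu
  obtain ⟨p, hp⟩ := hs
  have hpc := b.coord_eq_of_hasSum hp
  have h1 : ‖p‖ ≤ ‖x‖ := x.le_norm p fun n => by rw [hpc]; exact hu n
  have h2 : ‖z - p‖ ≤ ‖y‖ := y.le_norm _ fun n => by
    rw [map_sub, hpc]
    rcases (add_nonneg (norm_nonneg (x.coord n)) (norm_nonneg (y.coord n))).eq_or_lt' with h | h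
    · have h0 : b.coord n z = 0 := norm_le_zero_iff.1 (h ▸ hz' n)
      simp [u, h0]
    · have h1t : 1 - t n = ‖y.coord n‖ / (‖x.coord n‖ + ‖y.coord n‖) := by
        simp only [t]; field_simp; ring
      have h1t0 : 0 ≤ 1 - t n := by rw [h1t]; positivity
      have : b.coord n z - u n = b.coord n z * ((1 - t n : ℝ) : 𝕜) := by
        simp only [u]; push_cast; ring
      rw [this, norm_mul, RCLike.norm_ofReal, abs_of_nonneg h1t0]
      calc ‖b.coord n z‖ * (1 - t n) ≤ (‖x.coord n‖ + ‖y.coord n‖) * (1 - t n) := by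
            gcongr
            exact hz' n
        _ = ‖y.coord n‖ := by rw [h1t]; field_simp
  calc ‖z‖ = ‖p + (z - p)‖ := by rw [add_sub_cancel]
    _ ≤ ‖p‖ + ‖z - p‖ := norm_add_le _ _
    _ ≤ ‖x‖ + ‖y‖ := add_le_add h1 h2

lemma norm_smul_le' (c : 𝕜) (x : EDirectSum b X) : ‖c • x‖ ≤ ‖c‖ * ‖x‖ := by
  refine norm_le_of _ fun z hz => ?_
  have hz' : ∀ n, ‖b.coord n z‖ ≤ ‖c‖ * ‖x.coord n‖ := fun n => by
    rw [← norm_smul]; exact hz n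
  rcases eq_or_ne c 0 with rfl | hc
  · have : z = 0 := b.eq_zero_of_coords fun n => by simpa using hz' n
    simp [this]
  · have hc0 : 0 < ‖c‖ := norm_pos_iff.2 hc
    have := x.le_norm (c⁻¹ • z) fun n => by
      rw [map_smul, norm_smul, norm_inv, inv_mul_le_iff₀ hc0]
      exact hz' n
    rwa [norm_smul, norm_inv, inv_mul_le_iff₀ hc0] at this

lemma eq_zero_of_norm (x : EDirectSum b X) (hx : ‖x‖ = 0) : x = 0 := by
  refine Subtype.ext (funext fun n => ?_)
  have h := x.le_norm (((‖x.coord n‖ : ℝ) : 𝕜) • b n) fun k => by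
    rw [map_smul, b.ortho]
    rcases eq_or_ne k n with rfl | hk
    · simp
    · simp [hk]
  rw [hx, norm_smul, RCLike.norm_ofReal, abs_norm] at h
  have hb : 0 < ‖b n‖ := norm_pos_iff.2 (b.basis_ne_zero n)
  have : ‖x.coord n‖ ≤ 0 := by
    by_contra hcon
    push Not at hcon
    exact absurd h (not_le.2 (mul_pos hcon hb))
  exact norm_le_zero_iff.1 this

instance : NormedAddCommGroup (EDirectSum b X) :=
  AddGroupNorm.toNormedAddCommGroup
    { toFun := fun x => ‖x‖
      map_zero' := le_antisymm
        (by simpa using norm_smul_le' (0 : 𝕜) (0 : EDirectSum b X)) (norm_nonneg' _)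
      add_le' := norm_add_le'
      neg' := fun x => by
        have h : ∀ y : EDirectSum b X, ‖-y‖ ≤ ‖y‖ := fun y => by
          simpa using norm_smul_le' (-1 : 𝕜) y
        exact le_antisymm (h x) (by simpa using h (-x))
      eq_zero_of_map_eq_zero' := eq_zero_of_norm }

instance : NormedSpace 𝕜 (EDirectSum b X) where
  norm_smul_le := norm_smul_le'

/-- For a `1`-unconditional basis the norm of the direct sum is `‖∑ ‖xₙ‖ eₙ‖`. -/
lemma norm_eq (hb : b.IsOneUnconditional) (x : EDirectSum b X) :
    ‖x‖ = ‖∑' n, ((‖x.coord n‖ : ℝ) : 𝕜) • b n‖ := by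
  have hs := x.summable.hasSum
  refine le_antisymm (norm_le_of _ fun y hy => ?_) (x.le_norm _ fun n => ?_)
  · refine le_of_tendsto_of_tendsto (b.expansion y).norm hs.norm ?_
    refine Filter.Eventually.of_forall fun A => hb A _ _ fun n => ?_
    simpa using hy n
  · rw [b.coord_eq_of_hasSum hs n]
    simp

end EDirectSum

end DirectSum

end

noncomputable section

open scoped Topology

open Filter

/-! ### Calculus of Szlenk derivations and their transfer along maps. -/

section Szlenk

variable {𝕜 : Type*} [RCLike 𝕜] {X Y : Type*} [NormedAddCommGroup X] [NormedSpace 𝕜 X]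
  [NormedAddCommGroup Y] [NormedSpace 𝕜 Y]

/-! Send a functional `f` on the direct sum, with restrictions `fₙ` to the summands, to the
functional `u_f` on `E` with coefficients `‖fₙ‖`. Up to the unconditionality constant `C` this
nonlinear map carries the dual ball into the dual ball. It is weak*-continuous there: each `f ↦ fₙ`
is continuous into the norm topology because `Xₙ` is finite-dimensional, and on bounded sets
coordinatewise convergence is weak* convergence.

The map must not collapse distances near a given `f`. Close functionals `f`, `g` agree nearly in
norm on the first `N` summands. Beyond `N`, `‖gₙ - fₙ‖ ≤ ‖gₙ‖ + ‖fₙ‖`, and `u_g + u_f = (u_g - u_f)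
+ 2u_f`; so if the tail of `u_f` is small, `‖g - f‖` is at most about `‖u_g - u_f‖`
(`EDirectSum.norm_sub_le_of_tail`). Hence an `ε`-derivation upstairs maps into a `cε`-derivation
downstairs, and the bound on the sums passes from `E` to the direct sum
(`HasSummableSzlenkIndex.of_mapsTo`).

Small tails mean that the basis is shrinking, which the Szlenk hypothesis itself forces
(`UnconditionalSchauderBasis.exists_norm_apply_le_of_tail`): if some `u` had large tails, the
restrictions of a multiple of `u` to all subsets of `ℕ` would form a set contained in its own
derivation. -/

lemma szlenkDerivation_subset (ε : ℝ) (K : Set (WeakDual 𝕜 X)) : szlenkDerivation 𝕜 ε K ⊆ K :=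
  fun _ hf => hf.1

lemma szlenkDerivation_mono (ε : ℝ) {K K' : Set (WeakDual 𝕜 X)} (h : K ⊆ K') :
    szlenkDerivation 𝕜 ε K ⊆ szlenkDerivation 𝕜 ε K' := fun _ hf =>
  ⟨h hf.1, fun U hU hfU => (hf.2 U hU hfU).trans_le
    (Metric.ediam_mono (Set.image_mono (Set.inter_subset_inter_left U h)))⟩

lemma iteratedSzlenkDerivation_subset (l : List ℝ) (K : Set (WeakDual 𝕜 X)) :
    iteratedSzlenkDerivation 𝕜 l K ⊆ K := by
  induction l with
  | nil => exact subset_rfl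
  | cons ε l ih => exact (szlenkDerivation_subset ε _).trans ih

lemma subset_iteratedSzlenkDerivation_replicate {ε : ℝ} {K K' : Set (WeakDual 𝕜 X)}
    (hK : K ⊆ K') (h : K ⊆ szlenkDerivation 𝕜 ε K) (n : ℕ) :
    K ⊆ iteratedSzlenkDerivation 𝕜 (List.replicate n ε) K' := by
  induction n with
  | zero => exact hK
  | succ n ih => exact h.trans (szlenkDerivation_mono ε ih)

/-- Sufficient for a point of `K` to survive the `ε`-derivation: every weak* neighbourhood contains
two points of `K` at distance larger than `ε`. -/
lemma mem_szlenkDerivation {ε : ℝ} (hε : 0 ≤ ε) {K : Set (WeakDual 𝕜 X)} {f : WeakDual 𝕜 X}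
    (hf : f ∈ K)
    (h : ∀ U : Set (WeakDual 𝕜 X), IsOpen U → f ∈ U → ∃ g ∈ K ∩ U, ∃ g' ∈ K ∩ U,
      ε < ‖WeakDual.toStrongDual g - WeakDual.toStrongDual g'‖) :
    f ∈ szlenkDerivation 𝕜 ε K := by
  refine ⟨hf, fun U hU hfU => ?_⟩
  obtain ⟨g, hg, g', hg', hlt⟩ := h U hU hfU
  refine lt_of_lt_of_le ?_ (Metric.edist_le_ediam_of_mem (Set.mem_image_of_mem _ hg)
    (Set.mem_image_of_mem _ hg'))
  rw [edist_dist, dist_eq_norm]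
  exact (ENNReal.ofReal_lt_ofReal_iff_of_nonneg hε).2 hlt

/-- Every weak* neighbourhood of a point of the `ε`-derivation contains points of `K` at distance
larger than `ε / 2` from it. -/
lemma exists_dist_gt_of_mem_szlenkDerivation {ε : ℝ} {K : Set (WeakDual 𝕜 X)}
    {f : WeakDual 𝕜 X} (hf : f ∈ szlenkDerivation 𝕜 ε K) {U : Set (WeakDual 𝕜 X)} (hU : IsOpen U)
    (hfU : f ∈ U) :
    ∃ g ∈ K ∩ U, ε / 2 < ‖WeakDual.toStrongDual g - WeakDual.toStrongDual f‖ := by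
  by_contra! hcon
  refine absurd (hf.2 U hU hfU) (not_lt.2 (Metric.ediam_le ?_))
  rintro _ ⟨g, hg, rfl⟩ _ ⟨g', hg', rfl⟩
  rw [edist_dist]
  refine ENNReal.ofReal_le_ofReal ?_
  have h1 := hcon g hg
  have h2 := hcon g' hg'
  rw [← dist_eq_norm] at h1 h2
  have := dist_triangle_right (WeakDual.toStrongDual g) (WeakDual.toStrongDual g')
    (WeakDual.toStrongDual f)
  linarith

/-- Transfer of iterated derivations along a map that transfers single derivations. -/
lemma mapsTo_iteratedSzlenkDerivation {Φ : WeakDual 𝕜 X → WeakDual 𝕜 Y} {c : ℝ}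
    {A : Set (WeakDual 𝕜 X)} {B : Set (WeakDual 𝕜 Y)} (hAB : Set.MapsTo Φ A B)
    (h : ∀ ε, 0 < ε → ∀ K ⊆ A, ∀ K', Set.MapsTo Φ K K' →
      Set.MapsTo Φ (szlenkDerivation 𝕜 ε K) (szlenkDerivation 𝕜 (c * ε) K'))
    (l : List ℝ) (hl : ∀ ε ∈ l, 0 < ε) :
    Set.MapsTo Φ (iteratedSzlenkDerivation 𝕜 l A)
      (iteratedSzlenkDerivation 𝕜 (l.map (c * ·)) B) := by
  induction l with
  | nil => exact hAB
  | cons ε l ih =>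
    exact h ε (hl ε (by simp)) _ (iteratedSzlenkDerivation_subset l A) _
      (ih fun x hx => hl x (by simp [hx]))

/-- Survivors of `ε₁, …, εₙ` go to survivors of `cε₁, …, cεₙ`, so `c ∑ εᵢ ≤ M`. Only sets `K` inside
the ball are tested, so `Φ` need only behave well on bounded sets. -/
lemma HasSummableSzlenkIndex.of_mapsTo {Φ : WeakDual 𝕜 X → WeakDual 𝕜 Y} {c : ℝ} (hc : 0 < c)
    (hΦ : Set.MapsTo Φ (dualUnitBall 𝕜 X) (dualUnitBall 𝕜 Y))
    (h : ∀ ε, 0 < ε → ∀ K ⊆ dualUnitBall 𝕜 X, ∀ K', Set.MapsTo Φ K K' →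
      Set.MapsTo Φ (szlenkDerivation 𝕜 ε K) (szlenkDerivation 𝕜 (c * ε) K'))
    (hY : HasSummableSzlenkIndex 𝕜 Y) : HasSummableSzlenkIndex 𝕜 X := by
  obtain ⟨M, hM⟩ := hY
  refine ⟨M / c, fun l hl ⟨f, hf⟩ => ?_⟩
  have := hM (l.map (c * ·)) (by simpa using fun ε hε => mul_pos hc (hl ε hε))
    ⟨_, mapsTo_iteratedSzlenkDerivation hΦ h l hl hf⟩
  rw [List.sum_map_mul_left, List.map_id'] at this
  rwa [le_div_iff₀ hc, mul_comm]

/-- A point of such a `K` survives any number `n` of `ε`-derivations of the ball, which would force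
`nε ≤ M` for all `n`. -/
lemma HasSummableSzlenkIndex.eq_empty_of_subset_szlenkDerivation
    (hX : HasSummableSzlenkIndex 𝕜 X) {ε : ℝ} (hε : 0 < ε) {K : Set (WeakDual 𝕜 X)}
    (hK : K ⊆ dualUnitBall 𝕜 X) (h : K ⊆ szlenkDerivation 𝕜 ε K) : K = ∅ := by
  obtain ⟨M, hM⟩ := hX
  by_contra hne
  obtain ⟨f, hf⟩ := Set.nonempty_iff_ne_empty.2 hne
  obtain ⟨n, hn⟩ := exists_nat_gt (M / ε)
  have := hM (List.replicate n ε) (fun x hx => (List.eq_of_mem_replicate hx).symm ▸ hε)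
    ⟨f, subset_iteratedSzlenkDerivation_replicate hK h n hf⟩
  rw [List.sum_replicate, nsmul_eq_mul] at this
  rw [div_lt_iff₀ hε] at hn
  linarith

end Szlenk

/-! ### Unconditional bases: coordinatewise weak* topology, lattice constant, shrinking. -/

section Basis

variable {𝕜 E : Type*} [RCLike 𝕜] [NormedAddCommGroup E] [NormedSpace 𝕜 E]

namespace UnconditionalSchauderBasis

variable (b : UnconditionalSchauderBasis ℕ 𝕜 E)

lemma apply_eq_of_eq {u v : StrongDual 𝕜 E} {y : E}
    (h : ∀ n, b.coord n y ≠ 0 → u (b n) = v (b n)) : u y = v y := by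
  have hy : HasSum (fun n => b.coord n y • b n) y := b.expansion y
  refine (hy.mapL u).unique ((hy.mapL v).congr_fun fun n => ?_)
  by_cases h0 : b.coord n y = 0
  · simp [h0]
  · simp [h n h0]

/-- On bounded sets, weak* convergence is coordinatewise convergence. -/
lemma tendsto_weakDual {α : Type*} {l : Filter α} {F : α → WeakDual 𝕜 E} {v : WeakDual 𝕜 E}
    {R : ℝ} (hF : ∀ᶠ a in l, ‖WeakDual.toStrongDual (F a)‖ ≤ R)
    (h : ∀ n, Tendsto (fun a => F a (b n)) l (𝓝 (v (b n)))) : Tendsto F l (𝓝 v) := by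
  rw [tendsto_iff_forall_eval_tendsto_topDualPairing]
  intro y
  change Tendsto (fun a => F a y) l (𝓝 (v y))
  rw [Metric.tendsto_nhds]
  intro ε hε
  -- `S` bounds `‖F a - v‖` and is positive, so approximating `y` within `ε / (2S)` by a finite sum
  -- costs less than `ε / 2`.
  let S : ℝ := |R| + ‖WeakDual.toStrongDual v‖ + 1
  have hS : 0 < S := by positivity
  have hy : HasSum (fun n => b.coord n y • b n) y := b.expansion y
  obtain ⟨A, hA⟩ := (Metric.tendsto_nhds.1 (show Tendsto _ _ _ from hy) (ε / (2 * S))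
    (by positivity)).exists
  have hfin : Tendsto (fun a => F a (∑ n ∈ A, b.coord n y • b n)) l
      (𝓝 (v (∑ n ∈ A, b.coord n y • b n))) := by
    simp only [map_sum, map_smul]
    exact tendsto_finsetSum _ fun n _ => (h n).const_smul _
  filter_upwards [hF, Metric.tendsto_nhds.1 hfin (ε / 2) (by positivity)] with a ha hfa
  set p := ∑ n ∈ A, b.coord n y • b n
  rw [dist_eq_norm] at hfa hA ⊢
  have e1 : F a y - v y = (F a p - v p) - (WeakDual.toStrongDual (F a) -
      WeakDual.toStrongDual v) (p - y) := by
    rw [sub_apply, WeakDual.toStrongDual_apply, WeakDual.toStrongDual_apply,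
      map_sub, map_sub]
    ring
  have e2 : ‖(WeakDual.toStrongDual (F a) - WeakDual.toStrongDual v) (p - y)‖ ≤ S * ‖p - y‖ := by
    refine ContinuousLinearMap.le_of_opNorm_le _ ((norm_sub_le _ _).trans ?_) _
    have := le_abs_self R
    simp only [S]
    linarith
  have e3 : S * ‖p - y‖ < ε / 2 := by
    calc S * ‖p - y‖ < S * (ε / (2 * S)) := by gcongr
      _ = ε / 2 := by field_simp
  rw [e1]
  linarith [norm_sub_le (F a p - v p)
    ((WeakDual.toStrongDual (F a) - WeakDual.toStrongDual v) (p - y))]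

/-- Otherwise pick, for each `N`, a bounded `w N` outside `U` that agrees with `v` on the first `N`
basis vectors; these converge weak* to `v`. -/
lemma exists_forall_mem_of_isOpen {U : Set (WeakDual 𝕜 E)} (hU : IsOpen U) {v : WeakDual 𝕜 E}
    (hv : v ∈ U) (R : ℝ) : ∃ N : ℕ, ∀ w : WeakDual 𝕜 E, ‖WeakDual.toStrongDual w‖ ≤ R →
      (∀ n < N, w (b n) = v (b n)) → w ∈ U := by
  by_contra! hcon
  choose w hwR hw hwU using hcon
  have : Tendsto w atTop (𝓝 v) := b.tendsto_weakDual (Eventually.of_forall hwR) fun n => by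
    refine tendsto_const_nhds.congr' ?_
    filter_upwards [eventually_gt_atTop n] with N hN using (hw N n hN).symm
  obtain ⟨N, hN⟩ := (this.eventually (hU.mem_nhds hv)).exists
  exact hwU N hN

variable [CompleteSpace E]

/-- Uniform boundedness of the basis projections controls all subsums of the expansion of `y`, hence
all sums with multipliers in the unit disc. -/
lemma exists_norm_le_of_dominated : ∃ C : ℝ, 0 < C ∧
    ∀ y z : E, (∀ n, ‖b.coord n z‖ ≤ ‖b.coord n y‖) → ‖z‖ ≤ C * ‖y‖ := by
  obtain ⟨C, hC⟩ := b.exists_norm_proj_le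
  have hC0 : 0 ≤ C := (norm_nonneg _).trans (hC ∅)
  -- The factor `4` comes from passing from subsums to multipliers; `+ 1` makes the constant
  -- positive.
  refine ⟨4 * C + 1, by positivity, fun y z h => ?_⟩
  have key : ∀ A : Finset ℕ, ‖∑ n ∈ A, b.coord n z • b n‖ ≤ 4 * (C * ‖y‖) := fun A => by
    have := norm_sum_smul_le_of_subsums A (fun n => b.coord n y • b n)
      -- Where `b.coord n y = 0` the quotient is `0` by convention, which is right since then
      -- `b.coord n z = 0` too.
      (fun n => b.coord n z / b.coord n y) (C * ‖y‖)
      (fun n => by rw [norm_div]; exact div_le_one_of_le₀ (h n) (norm_nonneg _))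
      (fun B _ => by rw [← b.proj_apply]; exact (b.proj B).le_of_opNorm_le (hC B) y)
    refine le_of_eq_of_le (congrArg _ (Finset.sum_congr rfl fun n _ => ?_)) this
    rcases eq_or_ne (b.coord n y) 0 with h0 | h0
    · have : b.coord n z = 0 := norm_le_zero_iff.1 (by simpa [h0] using h n)
      simp [this]
    · rw [smul_smul, div_mul_cancel₀ _ h0]
  have hz : HasSum (fun n => b.coord n z • b n) z := b.expansion z
  have := le_of_tendsto hz.norm (Eventually.of_forall key)
  nlinarith [norm_nonneg y]

/-- Multiplication of the coordinates by the indicator function of a set is a bounded operator on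
functionals. -/
lemma exists_restrict {C : ℝ} (hC0 : 0 < C)
    (hC : ∀ y z : E, (∀ n, ‖b.coord n z‖ ≤ ‖b.coord n y‖) → ‖z‖ ≤ C * ‖y‖)
    (u : StrongDual 𝕜 E) (A : Set ℕ) :
    ∃ v : StrongDual 𝕜 E, ‖v‖ ≤ C * ‖u‖ ∧ ∀ n, v (b n) = A.indicator (fun k => u (b k)) n := by
  classical
  let c : ℕ → 𝕜 := A.indicator 1
  have hc : ∀ n, ‖c n‖ ≤ 1 := fun n => by
    by_cases h : n ∈ A <;> simp [c, h]
  have hs : ∀ y : E, HasSum (fun n => (c n * b.coord n y) • b n)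
      (∑' n, (c n * b.coord n y) • b n) := fun y => by
    have hy : HasSum (fun n => b.coord n y • b n) y := b.expansion y
    have := summable_smul_of_norm_le_one hy.summable hc
    simp only [smul_smul] at this
    exact this.hasSum
  let T : E →ₗ[𝕜] E :=
    { toFun := fun y => ∑' n, (c n * b.coord n y) • b n
      map_add' := fun y z => by
        refine (((hs y).add (hs z)).congr_fun ?_).tsum_eq
        intro n
        simp [mul_add, add_smul]
      map_smul' := fun a y => by
        refine (((hs y).const_smul a).congr_fun ?_).tsum_eq
        intro n
        simp [smul_smul, mul_left_comm] }
  have hT : ∀ y, ‖T y‖ ≤ C * ‖y‖ := fun y => hC _ _ fun n => by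
    rw [show b.coord n (T y) = c n * b.coord n y from b.coord_eq_of_hasSum (hs y) n, norm_mul]
    exact mul_le_of_le_one_left (norm_nonneg _) (hc n)
  have hTb : ∀ n, T (b n) = c n • b n := fun n => by
    refine (hs (b n)).unique ?_
    have := hasSum_single (f := fun k => (c k * b.coord k (b n)) • b k) n fun k hk => by
      simp [b.ortho, hk]
    simpa [b.ortho] using this
  refine ⟨u.comp (T.mkContinuous C hT), ?_, fun n => ?_⟩
  · refine (u.opNorm_comp_le _).trans ?_
    rw [mul_comm]
    gcongr
    exact T.mkContinuous_norm_le hC0.le hT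
  · by_cases h : n ∈ A <;> simp [hTb, c, h]

/-- An unconditional basis of a space with summable Szlenk index is shrinking. -/
lemma exists_norm_apply_le_of_tail (hE : HasSummableSzlenkIndex 𝕜 E) (u : StrongDual 𝕜 E)
    {δ : ℝ} (hδ : 0 < δ) :
    ∃ N : ℕ, ∀ y : E, (∀ n < N, b.coord n y = 0) → ‖u y‖ ≤ δ * ‖y‖ := by
  by_contra! hcon
  obtain ⟨C, hC0, hC⟩ := b.exists_norm_le_of_dominated
  -- With this scaling every restriction of `t • u` lies in the unit ball.
  let t : ℝ := (C * ‖u‖ + 1)⁻¹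
  have ht : 0 < t := by positivity
  let K : Set (WeakDual 𝕜 E) := {v | v ∈ dualUnitBall 𝕜 E ∧
    ∃ A : Set ℕ, ∀ n, v (b n) = A.indicator (fun k => (t : 𝕜) * u (b k)) n}
  have hex : ∀ A : Set ℕ, ∃ v ∈ K, ∀ n, v (b n) = A.indicator (fun k => (t : 𝕜) * u (b k)) n := by
    intro A
    obtain ⟨v, hv, hvA⟩ := b.exists_restrict hC0 hC ((t : 𝕜) • u) A
    refine ⟨StrongDual.toWeakDual v, ⟨?_, A, hvA⟩, hvA⟩
    change ‖v‖ ≤ 1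
    refine hv.trans ?_
    rw [norm_smul, RCLike.norm_ofReal, abs_of_pos ht]
    calc C * (t * ‖u‖) = (C * ‖u‖) * t := by ring
      _ ≤ (C * ‖u‖ + 1) * t := by gcongr; linarith
      _ = 1 := mul_inv_cancel₀ (by positivity)
  have hK : K ⊆ szlenkDerivation 𝕜 (t * δ) K := by
    rintro v hvK
    refine mem_szlenkDerivation (by positivity) hvK fun U hU hvU => ?_
    obtain ⟨A, hA⟩ := hvK.2
    obtain ⟨N, hN⟩ := b.exists_forall_mem_of_isOpen hU hvU 1
    obtain ⟨y, hy0, hy⟩ := hcon N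
    -- Both modifications keep `v` below `N`, hence stay in `U`. One has the full tail of `t • u`,
    -- the other none, so on `y`, supported beyond `N`, their difference equals `t • u`.
    obtain ⟨w, hwK, hw⟩ := hex (A ∩ Set.Iio N ∪ Set.Ici N)
    obtain ⟨w', hwK', hw'⟩ := hex (A ∩ Set.Iio N)
    refine ⟨w, ⟨hwK, hN w hwK.1 fun n hn => ?_⟩, w', ⟨hwK', hN w' hwK'.1 fun n hn => ?_⟩, ?_⟩
    · rw [hw, hA]
      by_cases h : n ∈ A <;> simp [h, hn]
    · rw [hw', hA]
      by_cases h : n ∈ A <;> simp [h, hn]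
    · have hwy : (WeakDual.toStrongDual w - WeakDual.toStrongDual w') y = ((t : 𝕜) • u) y := by
        refine b.apply_eq_of_eq fun n hn => ?_
        have hNn : N ≤ n := not_lt.1 fun h => hn (hy0 n h)
        rw [sub_apply, WeakDual.toStrongDual_apply,
          WeakDual.toStrongDual_apply, hw, hw']
        simp [hNn, not_lt.2 hNn]
      have h1 := (WeakDual.toStrongDual w - WeakDual.toStrongDual w').le_opNorm y
      rw [hwy, smul_apply, norm_smul, RCLike.norm_ofReal, abs_of_pos ht] at h1
      have h2 : t * δ * ‖y‖ < ‖WeakDual.toStrongDual w - WeakDual.toStrongDual w'‖ * ‖y‖ := by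
        refine lt_of_lt_of_le ?_ h1
        rw [mul_assoc]
        gcongr
      exact lt_of_mul_lt_mul_right h2 (norm_nonneg y)
  have := hE.eq_empty_of_subset_szlenkDerivation (by positivity) (fun v hv => hv.1) hK
  obtain ⟨v, hv, -⟩ := hex ∅
  simp [this] at hv

end UnconditionalSchauderBasis

end Basis

/-! ### Finite-dimensional spaces: norm attainment and topology of the dual. -/

lemma exists_norm_le_one_apply_eq_norm {𝕜 V : Type*} [RCLike 𝕜] [NormedAddCommGroup V]
    [NormedSpace 𝕜 V] [FiniteDimensional 𝕜 V] (φ : StrongDual 𝕜 V) :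
    ∃ x : V, ‖x‖ ≤ 1 ∧ φ x = (‖φ‖ : 𝕜) := by
  have : ProperSpace V := FiniteDimensional.proper_rclike 𝕜 V
  obtain ⟨x, hx, hmax⟩ := (isCompact_closedBall (0 : V) 1).exists_sSup_image_eq
    ⟨0, by simp⟩ (f := fun x => ‖φ x‖) (by fun_prop)
  rw [φ.sSup_unitClosedBall_eq_norm] at hmax
  rw [mem_closedBall_zero_iff] at hx
  rcases eq_or_ne (φ x) 0 with h0 | h0
  · exact ⟨0, by simp, by rw [hmax, h0]; simp⟩
  -- Rotate the maximiser by a unimodular scalar to make the value real and nonnegative.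
  · refine ⟨((‖φ x‖ : 𝕜) / φ x) • x, ?_, ?_⟩
    · rw [norm_smul, norm_div, RCLike.norm_ofReal, abs_norm, div_self (norm_ne_zero_iff.2 h0),
        one_mul]
      exact hx
    · rw [map_smul, smul_eq_mul, div_mul_cancel₀ _ h0, hmax]

/-- On a finite-dimensional space the weak* topology of the dual is the norm topology. -/
lemma continuous_toStrongDual_of_finiteDimensional {𝕜 V : Type*} [RCLike 𝕜] [NormedAddCommGroup V]
    [NormedSpace 𝕜 V] [FiniteDimensional 𝕜 V] :
    Continuous (WeakDual.toStrongDual : WeakDual 𝕜 V → StrongDual 𝕜 V) := by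
  have : FiniteDimensional 𝕜 (WeakDual 𝕜 V) :=
    LinearEquiv.finiteDimensional (WeakDual.toStrongDual (𝕜 := 𝕜) (E := V)).symm
  exact (WeakDual.toStrongDual (𝕜 := 𝕜) (E := V)).toLinearMap.continuous_of_finiteDimensional

/-! ### Functionals on the direct sum and their coefficient norms. -/

namespace EDirectSum

variable {𝕜 E : Type*} [RCLike 𝕜] [NormedAddCommGroup E] [NormedSpace 𝕜 E] [CompleteSpace E]
  {b : UnconditionalSchauderBasis ℕ 𝕜 E}
  {X : ℕ → Type*} [∀ n, NormedAddCommGroup (X n)] [∀ n, NormedSpace 𝕜 (X n)]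

@[ext]
lemma ext {x y : EDirectSum b X} (h : ∀ n, x.coord n = y.coord n) : x = y :=
  Subtype.ext (funext h)

lemma coord_sub (x y : EDirectSum b X) (n : ℕ) : (x - y).coord n = x.coord n - y.coord n := rfl

lemma coord_sum (A : Finset ℕ) (x : ℕ → EDirectSum b X) (n : ℕ) :
    (∑ k ∈ A, x k).coord n = ∑ k ∈ A, (x k).coord n :=
  map_sum ({ toFun := fun x => x.coord n, map_zero' := rfl, map_add' := fun _ _ => rfl } :
    EDirectSum b X →+ X n) x A

variable (b X) in
/-- The embedding of the `n`-th summand. -/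
def single (n : ℕ) : X n →L[𝕜] EDirectSum b X :=
  LinearMap.mkContinuous
    { toFun := fun x => ⟨Pi.single n x, summable_of_ne_finset_zero (s := {n}) fun k hk => by
        rw [Pi.single_eq_of_ne (by simpa using hk)]; simp⟩
      map_add' := fun x y => Subtype.ext (Pi.single_add n x y)
      map_smul' := fun c x => Subtype.ext (Pi.single_smul n c x) } ‖b n‖ fun x => by
    refine norm_le_of _ fun y hy => ?_
    have hyn : HasSum (fun k => b.coord k y • b k) y := b.expansion y
    have h1 := hasSum_single (f := fun k => b.coord k y • b k) n fun k hk => by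
      have := hy k
      change _ ≤ ‖(Pi.single n x : ∀ k, X k) k‖ at this
      rw [Pi.single_eq_of_ne hk, norm_zero, norm_le_zero_iff] at this
      rw [this, zero_smul]
    rw [hyn.unique h1, norm_smul, mul_comm]
    have := hy n
    change _ ≤ ‖(Pi.single n x : ∀ k, X k) n‖ at this
    rw [Pi.single_eq_same] at this
    gcongr

@[simp]
lemma coord_single_same (n : ℕ) (x : X n) : (single b X n x).coord n = x :=
  Pi.single_eq_same (M := X) n x

lemma coord_single_of_ne {n k : ℕ} (h : k ≠ n) (x : X n) : (single b X n x).coord k = 0 :=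
  Pi.single_eq_of_ne (M := X) h x

/-- The vector of `E` whose coordinates are the norms of the coordinates of `x`. -/
def normVec (x : EDirectSum b X) : E := ∑' n, ((‖x.coord n‖ : ℝ) : 𝕜) • b n

lemma hasSum_normVec (x : EDirectSum b X) :
    HasSum (fun n => ((‖x.coord n‖ : ℝ) : 𝕜) • b n) x.normVec := x.summable.hasSum

lemma coord_normVec (x : EDirectSum b X) (n : ℕ) :
    b.coord n x.normVec = ((‖x.coord n‖ : ℝ) : 𝕜) := b.coord_eq_of_hasSum x.hasSum_normVec n

lemma norm_normVec_le (x : EDirectSum b X) : ‖x.normVec‖ ≤ ‖x‖ :=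
  x.le_norm _ fun n => by rw [coord_normVec, RCLike.norm_ofReal, abs_norm]

lemma norm_coord_mul_le (x : EDirectSum b X) (n : ℕ) : ‖x.coord n‖ * ‖b n‖ ≤ ‖x‖ := by
  have := x.le_norm (((‖x.coord n‖ : ℝ) : 𝕜) • b n) fun k => by
    rw [map_smul, b.ortho]
    rcases eq_or_ne k n with rfl | hk
    · simp
    · simp [hk]
  rwa [norm_smul, RCLike.norm_ofReal, abs_norm] at this

lemma norm_mono {x y : EDirectSum b X} (h : ∀ n, ‖x.coord n‖ ≤ ‖y.coord n‖) : ‖x‖ ≤ ‖y‖ :=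
  norm_le_of _ fun z hz => y.le_norm z fun n => (hz n).trans (h n)

lemma norm_le_mul {C : ℝ}
    (hC : ∀ y z : E, (∀ n, ‖b.coord n z‖ ≤ ‖b.coord n y‖) → ‖z‖ ≤ C * ‖y‖)
    {x : EDirectSum b X} {y : E} (h : ∀ n, ‖x.coord n‖ ≤ ‖b.coord n y‖) : ‖x‖ ≤ C * ‖y‖ :=
  norm_le_of _ fun z hz => hC y z fun n => (hz n).trans (h n)

lemma coord_sum_single (A : Finset ℕ) (x : EDirectSum b X) (n : ℕ) :
    (∑ k ∈ A, single b X k (x.coord k)).coord n = if n ∈ A then x.coord n else 0 := by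
  rw [coord_sum]
  split_ifs with h
  · rw [Finset.sum_eq_single_of_mem n h fun k _ hk => coord_single_of_ne hk.symm _,
      coord_single_same]
  · exact Finset.sum_eq_zero fun k hk => coord_single_of_ne (ne_of_mem_of_not_mem hk h).symm _

/-- The remainder of `x` after a finite partial sum has the same coordinate norms as the remainder
of `normVec x` in `E`, which tends to zero. -/
lemma hasSum_single_coord (x : EDirectSum b X) :
    HasSum (fun n => single b X n (x.coord n)) x := by
  obtain ⟨C, hC0, hC⟩ := b.exists_norm_le_of_dominated
  refine tendsto_iff_norm_sub_tendsto_zero.2 ?_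
  have h := (tendsto_iff_norm_sub_tendsto_zero.1
    (show Tendsto _ _ _ from x.hasSum_normVec)).const_mul C
  rw [mul_zero] at h
  refine squeeze_zero (fun _ => norm_nonneg _) (fun A => norm_le_mul hC fun n => ?_) h
  rw [coord_sub, coord_sum_single, map_sub, coord_normVec, map_sum]
  have : ∑ k ∈ A, b.coord n (((‖x.coord k‖ : ℝ) : 𝕜) • b k) =
      if n ∈ A then ((‖x.coord n‖ : ℝ) : 𝕜) else 0 := by
    simp [b.ortho, Pi.single_apply]
  rw [this]
  split_ifs <;> simp

/-- The restriction of a functional to the `n`-th summand. -/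
def dualCoord (f : StrongDual 𝕜 (EDirectSum b X)) (n : ℕ) : StrongDual 𝕜 (X n) :=
  f.comp (single b X n)

lemma dualCoord_apply (f : StrongDual 𝕜 (EDirectSum b X)) (n : ℕ) (x : X n) :
    dualCoord f n x = f (single b X n x) := rfl

lemma dualCoord_sub (f g : StrongDual 𝕜 (EDirectSum b X)) (n : ℕ) :
    dualCoord (f - g) n = dualCoord f n - dualCoord g n := rfl

lemma continuous_dualCoord (n : ℕ) [FiniteDimensional 𝕜 (X n)] :
    Continuous fun f : WeakDual 𝕜 (EDirectSum b X) => dualCoord (WeakDual.toStrongDual f) n := by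
  have : Continuous fun f : WeakDual 𝕜 (EDirectSum b X) =>
      StrongDual.toWeakDual (dualCoord (WeakDual.toStrongDual f) n) :=
    WeakDual.continuous_of_continuous_eval fun x => WeakDual.eval_continuous (single b X n x)
  exact continuous_toStrongDual_of_finiteDimensional.comp this

/-- The functional on `E` with coefficients `‖fₙ‖`, where `fₙ` are the restrictions of `f`. -/
lemma exists_normDual [∀ n, FiniteDimensional 𝕜 (X n)] {C : ℝ} (hC0 : 0 < C)
    (hC : ∀ y z : E, (∀ n, ‖b.coord n z‖ ≤ ‖b.coord n y‖) → ‖z‖ ≤ C * ‖y‖)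
    (f : StrongDual 𝕜 (EDirectSum b X)) :
    ∃ u : StrongDual 𝕜 E, ‖u‖ ≤ C * ‖f‖ ∧ ∀ n, u (b n) = (‖dualCoord f n‖ : 𝕜) := by
  choose x hx hfx using fun n => exists_norm_le_one_apply_eq_norm (dualCoord f n)
  have hle : ∀ (y : E) n, ‖b.coord n y • x n‖ ≤ ‖b.coord n y‖ := fun y n => by
    rw [norm_smul]
    exact mul_le_of_le_one_right (norm_nonneg _) (hx n)
  -- `J` places `y` along the norming vectors `xₙ`; then `f ∘ J` takes the value `fₙ(xₙ) = ‖fₙ‖` at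
  -- `b n`.
  let J : E →ₗ[𝕜] EDirectSum b X :=
    { toFun := fun y => ⟨fun n => b.coord n y • x n, by
        have hy : HasSum (fun n => b.coord n y • b n) y := b.expansion y
        refine (summable_smul_of_norm_le_one hy.summable
          (c := fun n => ((‖b.coord n y • x n‖ : ℝ) : 𝕜) / b.coord n y) fun n => ?_).congr
          fun n => ?_
        · rw [norm_div, RCLike.norm_ofReal, abs_norm]
          exact div_le_one_of_le₀ (hle y n) (norm_nonneg _)
        · rcases eq_or_ne (b.coord n y) 0 with h0 | h0
          · simp [h0]
          · rw [smul_smul, div_mul_cancel₀ _ h0]⟩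
      map_add' := fun y z => Subtype.ext (funext fun n => by
        change b.coord n (y + z) • x n = b.coord n y • x n + b.coord n z • x n
        rw [map_add, add_smul])
      map_smul' := fun c y => Subtype.ext (funext fun n => by
        change b.coord n (c • y) • x n = c • b.coord n y • x n
        rw [map_smul, smul_eq_mul, mul_smul]) }
  have hJ : ∀ y, ‖J y‖ ≤ C * ‖y‖ := fun y => norm_le_mul hC (hle y)
  refine ⟨f.comp (J.mkContinuous C hJ), ?_, fun n => ?_⟩
  · refine (f.opNorm_comp_le _).trans ?_
    rw [mul_comm]
    gcongr
    exact J.mkContinuous_norm_le hC0.le hJ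
  · have : J (b n) = single b X n (x n) := by
      ext k
      change b.coord k (b n) • x k = _
      rcases eq_or_ne k n with rfl | hk
      · simp [b.ortho]
      · simp [b.ortho, hk, coord_single_of_ne hk]
    rw [← hfx n, dualCoord_apply, ← this]
    rfl

/-- Term by term, `‖h x‖ ≤ ∑ ‖hₙ‖ ‖xₙ‖ ≤ ∑ rₙ ‖xₙ‖`, and the last sum is `v` evaluated at `normVec
x`. -/
lemma norm_apply_le_norm_apply_normVec {h : StrongDual 𝕜 (EDirectSum b X)} {v : StrongDual 𝕜 E}
    {r : ℕ → ℝ} (hv : ∀ n, v (b n) = (r n : 𝕜)) (hr : ∀ n, ‖dualCoord h n‖ ≤ r n)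
    (x : EDirectSum b X) : ‖h x‖ ≤ ‖v x.normVec‖ := by
  have h1 := x.hasSum_single_coord.mapL h
  have h2 := (x.hasSum_normVec.mapL v).mapL (RCLike.reCLM : 𝕜 →L[ℝ] ℝ)
  rw [← h1.tsum_eq]
  refine (tsum_of_norm_bounded h2 fun n => ?_).trans (RCLike.re_le_norm _)
  rw [map_smul, hv, smul_eq_mul, ← RCLike.ofReal_mul, RCLike.reCLM_apply, RCLike.ofReal_re,
    ← dualCoord_apply, mul_comm]
  exact (dualCoord h n).le_of_opNorm_le (hr n) _

/-- If the tail of `u = (‖fₙ‖)ₙ` is small and the first coordinates of `g` are close to those of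
`f`, then the distance of `f` and `g` is controlled by that of `u` and `v = (‖gₙ‖)ₙ`. -/
lemma norm_sub_le_of_tail {f g : StrongDual 𝕜 (EDirectSum b X)} {u v : StrongDual 𝕜 E}
    (hu : ∀ n, u (b n) = (‖dualCoord f n‖ : 𝕜)) (hv : ∀ n, v (b n) = (‖dualCoord g n‖ : 𝕜))
    {N : ℕ} {δ : ℝ} (hδ : 0 ≤ δ)
    (hN : ∀ y : E, (∀ n < N, b.coord n y = 0) → ‖u y‖ ≤ δ * ‖y‖) :
    ‖g - f‖ ≤ ∑ n ∈ Finset.range N, ‖dualCoord g n - dualCoord f n‖ / ‖b n‖ +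
      (‖v - u‖ + 2 * δ) := by
  refine ContinuousLinearMap.opNorm_le_bound _ (by positivity) fun x => ?_
  -- Split `x` at `N`: the head `p` is estimated summand by summand, the tail `x - p` through `u`
  -- and `v`.
  let p := ∑ n ∈ Finset.range N, single b X n (x.coord n)
  have hp : ∀ n, (x - p).coord n = if n < N then 0 else x.coord n := fun n => by
    rw [coord_sub, coord_sum_single]
    by_cases h : n < N <;> simp [h]
  have hpx : ‖x - p‖ ≤ ‖x‖ := norm_mono fun n => by
    rw [hp]
    split_ifs <;> simp
  have h1 : ‖(g - f) p‖ ≤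
      (∑ n ∈ Finset.range N, ‖dualCoord g n - dualCoord f n‖ / ‖b n‖) * ‖x‖ := by
    rw [map_sum, Finset.sum_mul]
    refine (norm_sum_le _ _).trans (Finset.sum_le_sum fun n _ => ?_)
    rw [← dualCoord_apply, dualCoord_sub]
    have hb : 0 < ‖b n‖ := norm_pos_iff.2 (b.basis_ne_zero n)
    refine ((dualCoord g n - dualCoord f n).le_opNorm _).trans ?_
    rw [div_mul_eq_mul_div, mul_div_assoc]
    gcongr
    rw [le_div_iff₀ hb]
    exact x.norm_coord_mul_le n
  have h2 : ‖(g - f) (x - p)‖ ≤ (‖v - u‖ + 2 * δ) * ‖x‖ := by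
    have hle : ‖(g - f) (x - p)‖ ≤ ‖(v + u) (x - p).normVec‖ :=
      norm_apply_le_norm_apply_normVec (r := fun n => ‖dualCoord g n‖ + ‖dualCoord f n‖)
        (fun n => by rw [add_apply, hu, hv, RCLike.ofReal_add])
        (fun n => by rw [dualCoord_sub]; exact norm_sub_le _ _) _
    have hnv : ‖(x - p).normVec‖ ≤ ‖x‖ := (norm_normVec_le _).trans hpx
    have hut := hN (x - p).normVec fun n hn => by rw [coord_normVec, hp]; simp [hn]
    have hvu := (v - u).le_opNorm (x - p).normVec
    -- Writing `v + u = (v - u) + 2u` means that only the tail of `u`, not that of `v`, has to be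
    -- small; this is where `2 * δ` arises.
    have e : (v + u) (x - p).normVec = (v - u) (x - p).normVec + (u (x - p).normVec +
        u (x - p).normVec) := by
      rw [add_apply, sub_apply]
      ring
    rw [e] at hle
    calc _ ≤ _ := hle
      _ ≤ ‖(v - u) (x - p).normVec‖ + (‖u (x - p).normVec‖ + ‖u (x - p).normVec‖) :=
        (norm_add_le _ _).trans (by gcongr; exact norm_add_le _ _)
      _ ≤ (‖v - u‖ + 2 * δ) * ‖(x - p).normVec‖ := by linarith
      _ ≤ _ := by gcongr
  have e : (g - f) x = (g - f) p + (g - f) (x - p) := by rw [← map_add, add_sub_cancel]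
  rw [e, add_mul]
  exact (norm_add_le _ _).trans (add_le_add h1 h2)

end EDirectSum

/-! ### Transfer of the derivations from the direct sum to `E`. -/

/-- If `E` is a Banach space with an unconditional basis and summable Szlenk index, then for every
sequence of finite-dimensional Banach spaces `Xₙ` the direct sum `(⨁ Xₙ)_E` has summable Szlenk
index. -/
theorem mainTheorem5 {𝕜 : Type*} [RCLike 𝕜]
    {E : Type*} [NormedAddCommGroup E] [NormedSpace 𝕜 E] [CompleteSpace E]
    (b : UnconditionalSchauderBasis ℕ 𝕜 E) (hE : HasSummableSzlenkIndex 𝕜 E)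
    (X : ℕ → Type*) [∀ n, NormedAddCommGroup (X n)] [∀ n, NormedSpace 𝕜 (X n)]
    [∀ n, FiniteDimensional 𝕜 (X n)] :
    HasSummableSzlenkIndex 𝕜 (EDirectSum b X) := by

  obtain ⟨C, hC0, hC⟩ := b.exists_norm_le_of_dominated
  choose Ψ hΨnorm hΨ using EDirectSum.exists_normDual (b := b) (X := X) hC0 hC
  let Φ : WeakDual 𝕜 (EDirectSum b X) → WeakDual 𝕜 E := fun f =>
    StrongDual.toWeakDual (((C⁻¹ : ℝ) : 𝕜) • Ψ (WeakDual.toStrongDual f))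
  have hnorm : ∀ u : StrongDual 𝕜 E, ‖((C⁻¹ : ℝ) : 𝕜) • u‖ = C⁻¹ * ‖u‖ := fun u => by
    rw [norm_smul, RCLike.norm_ofReal, abs_of_pos (inv_pos.2 hC0)]
  have hball : Set.MapsTo Φ (dualUnitBall 𝕜 (EDirectSum b X)) (dualUnitBall 𝕜 E) := fun f hf => by
    change ‖((C⁻¹ : ℝ) : 𝕜) • Ψ (WeakDual.toStrongDual f)‖ ≤ 1
    rw [hnorm, inv_mul_le_iff₀ hC0, mul_one]
    exact (hΨnorm _).trans (mul_le_of_le_one_right hC0.le hf)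
  -- Continuity is relative to the ball, since coordinatewise convergence gives weak* convergence
  -- only on bounded sets.
  have hcont : ∀ f, Tendsto Φ (𝓝[dualUnitBall 𝕜 (EDirectSum b X)] f) (𝓝 (Φ f)) := fun f => by
    refine b.tendsto_weakDual (R := 1)
      (eventually_nhdsWithin_of_forall fun g hg => hball hg) fun n => ?_
    have h : Continuous fun g : WeakDual 𝕜 (EDirectSum b X) => ((C⁻¹ : ℝ) : 𝕜) *
        ((‖EDirectSum.dualCoord (WeakDual.toStrongDual g) n‖ : ℝ) : 𝕜) :=
      continuous_const.mul
        (RCLike.continuous_ofReal.comp (EDirectSum.continuous_dualCoord n).norm)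
    have e : ∀ g, Φ g (b n) = ((C⁻¹ : ℝ) : 𝕜) *
        ((‖EDirectSum.dualCoord (WeakDual.toStrongDual g) n‖ : ℝ) : 𝕜) := fun g => by
      rw [← hΨ]; rfl
    simp only [e]
    exact (h.tendsto f).mono_left nhdsWithin_le_nhds
  -- The `4⁻¹` is what remains of a distance above `ε / 2` after losing `ε / 8` on the head and `2 *
  -- (ε / 16)` on the tail; `C⁻¹` is the normalisation of `Φ`.
  refine hE.of_mapsTo (c := C⁻¹ * 4⁻¹) (by positivity) hball fun ε hε K hK K' hKK' f hf => ?_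
  refine mem_szlenkDerivation (by positivity) (hKK' hf.1) fun U hU hfU => ?_
  obtain ⟨N, hN⟩ := b.exists_norm_apply_le_of_tail hE (Ψ (WeakDual.toStrongDual f))
    (show 0 < ε / 16 by positivity)
  have hs : Continuous fun g : WeakDual 𝕜 (EDirectSum b X) => ∑ n ∈ Finset.range N,
      ‖EDirectSum.dualCoord (WeakDual.toStrongDual g) n -
        EDirectSum.dualCoord (WeakDual.toStrongDual f) n‖ / ‖b n‖ :=
    continuous_finsetSum _ fun n _ =>
      (((EDirectSum.continuous_dualCoord n).sub continuous_const).norm).div_const _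
  have hs' := hs.tendsto f
  simp only [sub_self, norm_zero, zero_div, Finset.sum_const_zero] at hs'
  -- Close to `f` within the ball, `Φ g` lies in `U` and the head of `g - f` is smaller than `ε /
  -- 8`.
  have hev := ((hcont f).eventually (hU.mem_nhds hfU)).and
    ((hs'.eventually_lt_const (show 0 < ε / 8 by positivity)).filter_mono nhdsWithin_le_nhds)
  obtain ⟨V, hV, hfV, hVs⟩ := mem_nhdsWithin.1 hev
  obtain ⟨g, ⟨hgK, hgV⟩, hg⟩ := exists_dist_gt_of_mem_szlenkDerivation hf hV hfV
  obtain ⟨hgU, hgs⟩ := hVs ⟨hgV, hK hgK⟩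
  refine ⟨Φ g, ⟨hKK' hgK, hgU⟩, Φ f, ⟨hKK' hf.1, hfU⟩, ?_⟩
  have key := EDirectSum.norm_sub_le_of_tail (hΨ (WeakDual.toStrongDual f))
    (hΨ (WeakDual.toStrongDual g)) (by positivity) hN
  have hd : ‖WeakDual.toStrongDual (Φ g) - WeakDual.toStrongDual (Φ f)‖ =
      C⁻¹ * ‖Ψ (WeakDual.toStrongDual g) - Ψ (WeakDual.toStrongDual f)‖ := by
    rw [← hnorm, smul_sub]
    rfl
  rw [hd, mul_assoc]
  gcongr
  linarith

end
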